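/- Let $\Gamma$ be a set (the lattice, for example $\mathbb Z^\nu$), and let $\mathcal A$ be a unital $C^*$-algebra which is one of the following. (a) A quantum spin lattice system on $\Gamma$: to every finite $I\subset\Gamma$ there belongs a unital $*$-subalgebra $\mathcal A(I)\subset\mathcal A$ isomorphic to a full matrix algebra $M_{k}(\mathbb C)$, with $k$ depending on $I$; for disjoint $I,J$ one has $\mathcal A(I\cup J)=\mathcal A(I)\otimes\mathcal A(J)$ (the two subalgebras commute and multiplication induces an isomorphism $\mathcal A(I)\otimes\mathcal A(J)\to\mathcal A(I\cup J)$); and $\bigcup_I\mathcal A(I)$ is norm dense in $\mathcal A$. (b) A fermion lattice system on $\Gamma$: there are $c_i\in\mathcal A$ ($i\in\Gamma$) with $\{c_i^*,c_j\}=\delta_{ij}\mathbf 1$ and $\{c_i,c_j\}=0$; $\mathcal A(I)$ is the $*$-algebra generated by $\{c_i : i\in I\}$, which is isomorphic to $M_{2^{|I|}}(\mathbb C)$; and $\bigcup_I\mathcal A(I)$ is norm dense in $\mathcal A$. A state is even if it is invariant under the $*$-automorphism $\Theta$ of $\mathcal A$ with $\Theta(c_i)=-c_i$. For a state $\rho$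 of $\mathcal A$ and a finite $I\subset\Gamma$ let $S_I(\rho)=-\mathrm{Tr}(D\log D)$, where $D$ is the density matrix of $\rho|_{\mathcal A(I)}$ with respect to the matrix trace $\mathrm{Tr}$ of $\mathcal A(I)$. For $J\subset\Gamma\setminus I$, finite or infinite, put $$\widetilde S_{I|J}(\rho)=\inf_{\Lambda\subset J,\ \Lambda\ \text{finite}}\bigl\{S_{I\cup\Lambda}(\rho)-S_\Lambda(\rho)\bigr\},\qquad I_\rho(I:J)=S_I(\rho)-\widetilde S_{I|J}(\rho).$$ Let $\mathcal F_b$ be any family of finite subsets of $\Gamma$ (for example all boxes in $\mathbb Z^\nu$ containing the origin), and let $A\mapsto\partial A$ assign to each finite $A\subset\Gamma$ a finite subset $\partial A\subset\Gamma$, the boundary of $A$; any notion of boundary is allowed. Let $\rho$ be a pure state in case (a), or a pure even state in case (b), and let $c>0$ be a constant. If $$S_A(\rho)\le c\,|\partial A|\qquad\text{for all }A\in\mathcal F_b,$$ then $$I_\rho(A:A^c)\le 2c\,|\partial A|\qquad\text{for all }A\in\mathcal F_b .$$ -/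

import Mathlib

open scoped ComplexOrder

noncomputable section

namespace QuantumLattice

/-! ### States -/

section States

variable {𝒜 : Type*} [CStarAlgebra 𝒜]

/-- The states of a unital C*-algebra: positive normalized linear functionals. -/
def stateSpace (𝒜 : Type*) [CStarAlgebra 𝒜] : Set (𝒜 →ₗ[ℂ] ℂ) :=
  {ρ | (∀ a : 𝒜, 0 ≤ ρ (star a * a)) ∧ ρ 1 = 1}

/-- A pure state is an extreme point of the convex set of states. -/
def IsPureState (ρ : 𝒜 →ₗ[ℂ] ℂ) : Prop :=
  ρ ∈ Set.extremePoints ℝ (stateSpace 𝒜)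

end States

/-! ### The two kinds of quantum lattice systems -/

/-- A quantum spin lattice system on `Γ` with total (quasi-local) C*-algebra `𝒜`. -/
structure SpinSystem (Γ : Type*) (𝒜 : Type*) [DecidableEq Γ] [CStarAlgebra 𝒜] where
  /-- The local algebra of a finite region. -/
  loc : Finset Γ → StarSubalgebra ℂ 𝒜
  /-- Every local algebra is isomorphic to a full matrix algebra. -/
  fullMatrix : ∀ I, ∃ k : ℕ, Nonempty (loc I ≃⋆ₐ[ℂ] Matrix (Fin k) (Fin k) ℂ)
  /-- `𝒜(I ∪ J) = 𝒜(I) ⊗ 𝒜(J)` for disjoint `I`, `J`: the two factors commute, ... -/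
  commute : ∀ I J, Disjoint I J → ∀ a ∈ loc I, ∀ b ∈ loc J, Commute a b
  /-- ... the multiplication map `𝒜(I) ⊗ 𝒜(J) → 𝒜` is injective, ... -/
  linearDisjoint : ∀ I J, Disjoint I J →
    (loc I).toSubalgebra.LinearDisjoint (loc J).toSubalgebra
  /-- ... and its image is `𝒜(I ∪ J)`. -/
  union : ∀ I J, Disjoint I J → loc (I ∪ J) = loc I ⊔ loc J
  /-- The local elements are norm dense. -/
  dense : Dense (⋃ I, (loc I : Set 𝒜))

/-- The `*`-subalgebra generated by the annihilation (and creation) operators in `I`. -/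
def carLocal {Γ 𝒜 : Type*} [CStarAlgebra 𝒜] (c : Γ → 𝒜) (I : Finset Γ) :
    StarSubalgebra ℂ 𝒜 :=
  StarAlgebra.adjoin ℂ (c '' (I : Set Γ))

/-- A (spinless) fermion lattice system on `Γ` with total C*-algebra `𝒜`. -/
structure FermionSystem (Γ : Type*) (𝒜 : Type*) [DecidableEq Γ] [CStarAlgebra 𝒜] where
  /-- The annihilation operators; the creation operators are their adjoints. -/
  c : Γ → 𝒜
  /-- `{c_i^*, c_j} = δ_{ij} 1` -/
  anticomm_star : ∀ i j, star (c i) * c j + c j * star (c i) = if i = j then 1 else 0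
  /-- `{c_i, c_j} = 0`; the relation for the creation operators is its adjoint. -/
  anticomm : ∀ i j, c i * c j + c j * c i = 0
  /-- The local elements are norm dense. -/
  dense : Dense (⋃ I, (carLocal c I : Set 𝒜))

namespace FermionSystem

variable {Γ 𝒜 : Type*} [DecidableEq Γ] [CStarAlgebra 𝒜]

/-- The local algebra of a finite region. -/
def loc (F : FermionSystem Γ 𝒜) (I : Finset Γ) : StarSubalgebra ℂ 𝒜 :=
  carLocal F.c I

/-- `Θ` is the fermion grading automorphism. It is unique, as the `c i` generate `𝒜`. -/
def IsGrading (F : FermionSystem Γ 𝒜) (Θ : 𝒜 ≃⋆ₐ[ℂ] 𝒜) : Prop :=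
  ∀ i, Θ (F.c i) = -F.c i

/-- Even functionals: those invariant under the fermion grading. -/
def IsEven (F : FermionSystem Γ 𝒜) (ρ : 𝒜 →ₗ[ℂ] ℂ) : Prop :=
  ∃ Θ : 𝒜 ≃⋆ₐ[ℂ] 𝒜, F.IsGrading Θ ∧ ∀ a, ρ (Θ a) = ρ a

end FermionSystem

/-! ### Entropies -/

section Entropy

/-- `-Tr (D log D)`, with the logarithm given by the functional calculus of Hermitian
matrices and `0 log 0 = 0`. -/
def matrixEntropy {k : ℕ} (D : Matrix (Fin k) (Fin k) ℂ) : ℝ :=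
  -(Matrix.trace (D * cfc Real.log D)).re

variable {Γ 𝒜 : Type*} [DecidableEq Γ] [CStarAlgebra 𝒜]

/-- The density matrix `D` of the restriction of `ρ` to a subalgebra `B`, when `B` is
identified with a full matrix algebra by `e`; that is, `ρ x = Tr (D * e x)` for `x` in `B`. -/
def densityMatrix {B : StarSubalgebra ℂ 𝒜} {k : ℕ}
    (e : B ≃⋆ₐ[ℂ] Matrix (Fin k) (Fin k) ℂ) (ρ : 𝒜 →ₗ[ℂ] ℂ) : Matrix (Fin k) (Fin k) ℂ :=
  Matrix.of fun i j => ρ (e.symm (Matrix.single j i 1))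

/-- The defining property of the density matrix. -/
theorem apply_eq_trace_densityMatrix {B : StarSubalgebra ℂ 𝒜} {k : ℕ}
    (e : B ≃⋆ₐ[ℂ] Matrix (Fin k) (Fin k) ℂ) (ρ : 𝒜 →ₗ[ℂ] ℂ) (x : B) :
    ρ x = Matrix.trace (densityMatrix e ρ * e x) := by
  have h : ∀ M : Matrix (Fin k) (Fin k) ℂ,
      ρ (e.symm M) = Matrix.trace (densityMatrix e ρ * M) := by
    intro M
    have hs : ∀ i j, e.symm (Matrix.single i j (M i j)) =
        M i j • e.symm (Matrix.single i j 1) := by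
      intro i j
      rw [← map_smul, Matrix.smul_single, smul_eq_mul, mul_one]
    conv_lhs => rw [Matrix.matrix_eq_sum_single M]
    simp only [map_sum, hs, AddSubmonoidClass.coe_finsetSum, SetLike.val_smul, map_smul,
      smul_eq_mul, Matrix.trace, Matrix.diag, Matrix.mul_apply, densityMatrix, Matrix.of_apply]
    rw [Finset.sum_comm]
    exact Finset.sum_congr rfl fun i _ => Finset.sum_congr rfl fun j _ => mul_comm _ _
  simpa using h (e x)

open Classical in
/-- The von Neumann entropy of `ρ` on a subalgebra `B` that is isomorphic to a full matrix
algebra, as all local algebras of spin and fermion lattice systems are. The value does not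
depend on the isomorphism. -/
def vonNeumannEntropy (B : StarSubalgebra ℂ 𝒜) (ρ : 𝒜 →ₗ[ℂ] ℂ) : ℝ :=
  if h : ∃ k : ℕ, Nonempty (B ≃⋆ₐ[ℂ] Matrix (Fin k) (Fin k) ℂ) then
    matrixEntropy (densityMatrix h.choose_spec.some ρ)
  else 0

/-- The conditional entropy of `ρ` on the finite region `I` given the (finite or infinite)
region `J`: the infimum of `S_{I ∪ Λ}(ρ) - S_Λ(ρ)` over all finite `Λ ⊆ J`. -/
def conditionalEntropy (loc : Finset Γ → StarSubalgebra ℂ 𝒜) (ρ : 𝒜 →ₗ[ℂ] ℂ)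
    (I : Finset Γ) (J : Set Γ) : EReal :=
  ⨅ (Λ : Finset Γ) (_ : (Λ : Set Γ) ⊆ J),
    ((vonNeumannEntropy (loc (I ∪ Λ)) ρ - vonNeumannEntropy (loc Λ) ρ : ℝ) : EReal)

/-- The mutual entropy of `ρ` between the finite region `I` and the region `J`. -/
def mutualEntropy (loc : Finset Γ → StarSubalgebra ℂ 𝒜) (ρ : 𝒜 →ₗ[ℂ] ℂ)
    (I : Finset Γ) (J : Set Γ) : EReal :=
  (vonNeumannEntropy (loc I) ρ : EReal) - conditionalEntropy loc ρ I J

end Entropy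

end QuantumLattice

end

/-! The whole bound rests on the Araki-Lieb triangle inequality `S_J ≤ S_I + S_{I ∪ J}` for disjoint
finite regions. With `I = A` and `J = Λ ⊆ Aᶜ` it says `S_{A ∪ Λ} - S_Λ ≥ -S_A`. Hence the infimum
over `Λ` is at least `-S_A`, and the mutual entropy is at most `2 S_A`, which the area law for `S_A`
controls (`mutualEntropy_compl_le`).

For two commuting full matrix algebras the inequality is `vonNeumannEntropy_range_le_add`. The state
on their product is purified by a tripartite array `X a b r`, where `r` runs over the spectrum of
the joint density matrix. Complementary marginals of a pure vector have equal spectra, so the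
entropy of `b` is that of `(a, r)`. The latter is at most the Shannon entropy of the diagonal, which
Shannon subadditivity bounds by the entropies of `a` and of `r`. `sum_negMulLog_marginal_le` carries
this out with sums of numbers only.

Spin algebras of disjoint regions commute, so the inequality applies at once. Fermion algebras do
not commute, and the Jordan-Wigner map `exists_twist` replaces `F.loc J` by a copy commuting with
`F.loc I`. For an even state the copy has the same entropy, and together with `F.loc I` it generates
`F.loc (I ∪ J)`. -/

namespace QuantumLattice

open Real (negMulLog)

/-! ### Inequalities for Shannon entropy. -/

section ClassicalEntropy

/-- Pointwise Gibbs inequality, from `log t ≤ t - 1` at `t = y / x`. The condition `h` is needed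
because `Real.log 0 = 0`, whereas relative entropy would be infinite there. -/
theorem sub_le_mul_log_sub_mul_log {x y : ℝ} (hx : 0 ≤ x) (hy : 0 ≤ y) (h : y = 0 → x = 0) :
    x - y ≤ x * Real.log x - x * Real.log y := by
  rcases hx.eq_or_lt with rfl | hx'
  · simpa using hy
  have hy' : 0 < y := hy.lt_of_ne fun h0 => hx'.ne' (h h0.symm)
  have h1 := Real.log_le_sub_one_of_pos (div_pos hy' hx')
  rw [Real.log_div hy'.ne' hx'.ne'] at h1
  have h2 := mul_le_mul_of_nonneg_left h1 hx
  have h3 : x * (y / x - 1) = y - x := by field_simp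
  rw [h3] at h2
  linarith

/-- Jensen's inequality for `-x log x` with weights of total mass at most one. -/
theorem sum_mul_negMulLog_le {ι : Type*} [Fintype ι] (w β : ι → ℝ) (hw : ∀ i, 0 ≤ w i)
    (hβ : ∀ i, 0 ≤ β i) (h1 : ∑ i, w i ≤ 1) :
    ∑ i, w i * negMulLog (β i) ≤ negMulLog (∑ i, w i * β i) := by
  set q := ∑ i, w i * β i with hq
  have hq0 : 0 ≤ q := Finset.sum_nonneg fun i _ => mul_nonneg (hw i) (hβ i)
  -- Summed over `i`, the left side becomes `q * (1 - ∑ w i)`, which is nonnegative; this is why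
  -- total mass below one is harmless.
  have key : ∀ i, w i * β i - w i * q ≤ -(w i * negMulLog (β i)) - w i * β i * Real.log q := by
    intro i
    rcases (hw i).eq_or_lt with h0 | hpos
    · simp [← h0]
    have h := sub_le_mul_log_sub_mul_log (hβ i) hq0 fun h0 => by
      have := (Finset.sum_eq_zero_iff_of_nonneg
        fun i _ => mul_nonneg (hw i) (hβ i)).1 (hq.symm.trans h0) i (Finset.mem_univ i)
      exact (mul_eq_zero.1 this).resolve_left hpos.ne'
    have := mul_le_mul_of_nonneg_left h (hw i)
    simp only [negMulLog]
    linarith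
  have hs := Finset.sum_le_sum fun i (_ : i ∈ Finset.univ) => key i
  rw [Finset.sum_sub_distrib, Finset.sum_sub_distrib, ← Finset.sum_mul, ← Finset.sum_mul,
    Finset.sum_neg_distrib, ← hq] at hs
  have := mul_le_mul_of_nonneg_right h1 hq0
  simp only [negMulLog] at hs ⊢
  linarith

/-- Subadditivity of the Shannon entropy. -/
theorem sum_negMulLog_le_add {ι κ : Type*} [Fintype ι] [Fintype κ] (q : ι → κ → ℝ) (α : ι → ℝ)
    (p : κ → ℝ) (hq : ∀ i j, 0 ≤ q i j) (hα : ∀ i, ∑ j, q i j = α i)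
    (hp : ∀ j, ∑ i, q i j = p j) (h1 : ∑ i, α i = 1) :
    ∑ i, ∑ j, negMulLog (q i j) ≤ ∑ i, negMulLog (α i) + ∑ j, negMulLog (p j) := by
  have hα0 : ∀ i, 0 ≤ α i := fun i => hα i ▸ Finset.sum_nonneg fun j _ => hq i j
  have hp0 : ∀ j, 0 ≤ p j := fun j => hp j ▸ Finset.sum_nonneg fun i _ => hq i j
  have zα : ∀ i j, α i = 0 → q i j = 0 := fun i j h0 =>
    (Finset.sum_eq_zero_iff_of_nonneg fun j _ => hq i j).1 ((hα i).trans h0) j (Finset.mem_univ j)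
  have zp : ∀ i j, p j = 0 → q i j = 0 := fun i j h0 =>
    (Finset.sum_eq_zero_iff_of_nonneg fun i _ => hq i j).1 ((hp j).trans h0) i (Finset.mem_univ i)
  have p1 : ∑ j, p j = 1 := by
    simp_rw [← hp]
    rw [Finset.sum_comm]
    simp_rw [hα, h1]
  -- The sum of these bounds is nonnegativity of the relative entropy of `q` with respect to the
  -- product of its marginals; the linear terms cancel since both have mass one.
  have key : ∀ i j, negMulLog (q i j) ≤
      α i * p j - q i j + (-(q i j * Real.log (α i)) - q i j * Real.log (p j)) := by
    intro i j
    have h := sub_le_mul_log_sub_mul_log (hq i j) (mul_nonneg (hα0 i) (hp0 j)) fun h0 =>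
      (mul_eq_zero.1 h0).elim (zα i j) (zp i j)
    have hlog : q i j * Real.log (α i * p j) =
        q i j * Real.log (α i) + q i j * Real.log (p j) := by
      by_cases h0 : q i j = 0
      · simp [h0]
      · rw [Real.log_mul (mt (zα i j) h0) (mt (zp i j) h0), mul_add]
    rw [hlog] at h
    simp only [negMulLog]
    linarith
  refine (Finset.sum_le_sum fun i _ => Finset.sum_le_sum fun j _ => key i j).trans_eq ?_
  have e1 : ∑ i, ∑ j, α i * p j = 1 := by simp_rw [← Finset.mul_sum, p1, mul_one, h1]
  have e2 : ∑ i, ∑ j, q i j = 1 := by simp_rw [hα, h1]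
  have e3 : ∑ i, ∑ j, q i j * Real.log (α i) = -∑ i, negMulLog (α i) := by
    simp_rw [← Finset.sum_mul, hα, negMulLog, ← Finset.sum_neg_distrib]
    simp
  have e4 : ∑ i, ∑ j, q i j * Real.log (p j) = -∑ j, negMulLog (p j) := by
    rw [Finset.sum_comm]
    simp_rw [← Finset.sum_mul, hp, negMulLog, ← Finset.sum_neg_distrib]
    simp
  simp only [Finset.sum_add_distrib, Finset.sum_sub_distrib, Finset.sum_neg_distrib, e1, e2, e3, e4]
  ring

/-- The triangle inequality for the entropies of the marginals of a tripartite vector `X`, one of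
which is given in a basis that diagonalizes it. -/
theorem sum_negMulLog_marginal_le {m n κ : Type*} [Fintype m] [Fintype n] [Fintype κ]
    [DecidableEq n] (X : m → n → κ → ℂ) (α : m → ℝ) (β : n → ℝ) (p : κ → ℝ)
    (hα : ∀ a, ∑ b, ∑ r, Complex.normSq (X a b r) = α a)
    (hp : ∀ r, ∑ a, ∑ b, Complex.normSq (X a b r) = p r)
    (hβ : ∀ b b', ∑ a, ∑ r, star (X a b r) * X a b' r = if b = b' then (β b : ℂ) else 0)
    (h1 : ∑ a, α a = 1) :
    ∑ b, negMulLog (β b) ≤ ∑ a, negMulLog (α a) + ∑ r, negMulLog (p r) := by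
  have hβd : ∀ b, ∑ a, ∑ r, Complex.normSq (X a b r) = β b := by
    intro b
    have h := hβ b b
    rw [if_pos rfl] at h
    rw [← Complex.ofReal_inj, ← h]
    push_cast
    simp [Complex.normSq_eq_conj_mul_self]
  have hβ0 : ∀ b, 0 ≤ β b := fun b => hβd b ▸
    Finset.sum_nonneg fun a _ => Finset.sum_nonneg fun r _ => Complex.normSq_nonneg _
  have hz : ∀ a b r, β b = 0 → Complex.normSq (X a b r) = 0 := by
    intro a b r h0
    have h2 := (Finset.sum_eq_zero_iff_of_nonneg fun a _ =>
      Finset.sum_nonneg fun r _ => Complex.normSq_nonneg (X a b r)).1 ((hβd b).trans h0) a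
      (Finset.mem_univ a)
    exact (Finset.sum_eq_zero_iff_of_nonneg fun r _ => Complex.normSq_nonneg (X a b r)).1 h2 r
      (Finset.mem_univ r)
  -- Squared entries of the normalized eigenvectors of the `(a, r)` marginal, with eigenvalues `β
  -- b`. Where `β b = 0` the quotient is `0` by convention, and the numerator vanishes too.
  let w : m → κ → n → ℝ := fun a r b => Complex.normSq (X a b r) / β b
  have hw0 : ∀ a r b, 0 ≤ w a r b := fun a r b => div_nonneg (Complex.normSq_nonneg _) (hβ0 b)
  have hwβ : ∀ a r b, w a r b * β b = Complex.normSq (X a b r) := by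
    intro a r b
    by_cases h0 : β b = 0
    · simp [h0, hz a b r h0]
    · exact div_mul_cancel₀ _ h0
  -- Bessel's inequality: by `hβ` the slices `X · b ·`, divided by `√(β b)`, are orthonormal, and `w
  -- a r b` is the squared modulus of a coordinate.
  have hw1 : ∀ a r, ∑ b, w a r b ≤ 1 := by
    classical
    intro a r
    let v : {b // β b ≠ 0} → EuclideanSpace ℂ (m × κ) := fun b =>
      WithLp.toLp 2 fun x => ((√(β b))⁻¹ : ℝ) * X x.1 b x.2
    have hv : Orthonormal ℂ v := by
      rw [orthonormal_iff_ite]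
      rintro ⟨b, hb⟩ ⟨b', hb'⟩
      have : inner ℂ (v ⟨b, hb⟩) (v ⟨b', hb'⟩) =
          ((√(β b))⁻¹ : ℝ) * ((√(β b'))⁻¹ : ℝ) * ∑ a, ∑ r, star (X a b r) * X a b' r := by
        simp only [v, PiLp.inner_apply, RCLike.inner_apply, Fintype.sum_prod_type, Finset.mul_sum]
        refine Finset.sum_congr rfl fun _ _ => Finset.sum_congr rfl fun _ _ => ?_
        simp
        ring
      rw [this, hβ]
      by_cases h : b = b'
      · subst h
        have h2 : ((√(β b))⁻¹ : ℝ) * ((√(β b))⁻¹ : ℝ) * β b = 1 := by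
          rw [← mul_inv, Real.mul_self_sqrt (hβ0 b), inv_mul_cancel₀ hb]
        simp only [if_true]
        exact_mod_cast h2
      · simp [h]
    have hB := hv.sum_inner_products_le (EuclideanSpace.single (a, r) (1 : ℂ))
      (s := Finset.univ)
    rw [show ‖EuclideanSpace.single (a, r) (1 : ℂ)‖ = 1 by simp, one_pow] at hB
    refine le_trans (le_of_eq ?_) hB
    have e1 : ∀ b : {b // β b ≠ 0}, ‖inner ℂ (v b) (EuclideanSpace.single (a, r) (1 : ℂ))‖ ^ 2 =
        w a r b := by
      intro b
      rw [EuclideanSpace.inner_single_right]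
      simp only [v, w, one_mul, map_mul, norm_mul, Complex.conj_ofReal, Complex.norm_real, mul_pow,
        RCLike.norm_conj, Real.norm_eq_abs, sq_abs, inv_pow, Real.sq_sqrt (hβ0 b),
        ← Complex.normSq_eq_norm_sq]
      rw [div_eq_inv_mul]
    rw [Finset.sum_congr rfl fun b _ => e1 b,
      ← Finset.sum_subtype (Finset.univ.filter fun b => β b ≠ 0) (by simp) (w a r)]
    refine (Finset.sum_filter_of_ne (p := fun b => β b ≠ 0) fun b _ h h0 => h ?_).symm
    simp [w, h0]
  refine le_trans ?_ (sum_negMulLog_le_add (fun a r => ∑ b, Complex.normSq (X a b r)) α p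
    (fun a r => Finset.sum_nonneg fun b _ => Complex.normSq_nonneg _)
    (fun a => by rw [Finset.sum_comm]; exact hα a) hp h1)
  -- The diagonal entries are `∑ b, w a r b * β b`, so Jensen shows that passing to the diagonal
  -- does not lower the entropy.
  calc ∑ b, negMulLog (β b) = ∑ b, (∑ a, ∑ r, w a r b) * negMulLog (β b) := by
        refine Finset.sum_congr rfl fun b _ => ?_
        by_cases h0 : β b = 0
        · simp [h0]
        · have : ∑ a, ∑ r, w a r b = 1 := by
            simp only [w, ← Finset.sum_div, hβd, div_self h0]
          rw [this, one_mul]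
    _ = ∑ a, ∑ r, ∑ b, w a r b * negMulLog (β b) := by
        simp only [Finset.sum_mul]
        rw [Finset.sum_comm]
        exact Finset.sum_congr rfl fun a _ => Finset.sum_comm
    _ ≤ _ := by
        refine Finset.sum_le_sum fun a _ => Finset.sum_le_sum fun r _ => ?_
        refine (sum_mul_negMulLog_le _ _ (hw0 a r) hβ0 (hw1 a r)).trans_eq ?_
        simp_rw [hwβ]

end ClassicalEntropy

/-! ### Density matrices and their spectra. -/

section Spectral

open Matrix

variable {ι : Type*} [Fintype ι] [DecidableEq ι]

theorem trace_mul_cfc_log {D : Matrix ι ι ℂ} (hD : D.IsHermitian) :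
    -(trace (D * cfc Real.log D)).re = ∑ i, negMulLog (hD.eigenvalues i) := by
  rw [hD.cfc_eq, IsHermitian.cfc]
  conv_lhs =>
    enter [1, 1, 1, 1]
    rw [hD.spectral_theorem]
  rw [← map_mul, diagonal_mul_diagonal, Matrix.trace_map, trace_diagonal, Complex.re_sum,
    ← Finset.sum_neg_distrib]
  refine Finset.sum_congr rfl fun i _ => ?_
  simp [negMulLog]

/-- The entropy is invariant under `*`-isomorphisms of matrix algebras. -/
theorem trace_mul_cfc_map {κ : Type*} [Fintype κ] [DecidableEq κ]
    (φ : Matrix ι ι ℂ ≃⋆ₐ[ℂ] Matrix κ κ ℂ) {D : Matrix ι ι ℂ} (hD : D.IsHermitian) (f : ℝ → ℝ) :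
    trace (φ D * cfc f (φ D)) = trace (D * cfc f D) := by
  have hc : Continuous φ :=
    LinearMap.continuous_of_finiteDimensional (φ : Matrix ι ι ℂ →ₗ[ℂ] Matrix κ κ ℂ)
  have hs : IsSelfAdjoint (φ D) := (show IsSelfAdjoint D from hD).map φ
  have hf : ContinuousOn f (spectrum ℝ D) := (Matrix.finite_real_spectrum (A := D)).continuousOn f
  rw [← StarAlgHomClass.map_cfc (S := ℂ) φ f D hf hc hD hs, ← map_mul, Matrix.trace_map]
  rfl

variable {𝒜 : Type*} [CStarAlgebra 𝒜]

theorem nontrivial_of_mem_stateSpace {ρ : 𝒜 →ₗ[ℂ] ℂ} (hρ : ρ ∈ stateSpace 𝒜) : Nontrivial 𝒜 := by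
  refine ⟨1, 0, fun h => ?_⟩
  have := hρ.2
  rw [h, map_zero] at this
  exact zero_ne_one this

theorem starAlgHom_injective [Nontrivial 𝒜] (f : Matrix ι ι ℂ →⋆ₐ[ℂ] 𝒜) :
    Function.Injective f := by
  cases isEmpty_or_nonempty ι
  · exact Function.injective_of_subsingleton _
  · exact (f : Matrix ι ι ℂ →+* 𝒜).injective

/-- The reindexing of square matrices as a `*`-isomorphism. -/
noncomputable def reindexStarAlgEquiv {κ : Type*} [Fintype κ] [DecidableEq κ] (e : ι ≃ κ) :
    Matrix ι ι ℂ ≃⋆ₐ[ℂ] Matrix κ κ ℂ :=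
  StarAlgEquiv.ofAlgEquiv (reindexAlgEquiv ℂ ℂ e) fun _ => rfl

/-- The matrix `D` with `ρ (f M) = Tr (D M)`. -/
noncomputable def pullbackDensity (f : Matrix ι ι ℂ →⋆ₐ[ℂ] 𝒜) (ρ : 𝒜 →ₗ[ℂ] ℂ) : Matrix ι ι ℂ :=
  Matrix.of fun i j => ρ (f (Matrix.single j i 1))

theorem apply_eq_trace_pullbackDensity (f : Matrix ι ι ℂ →⋆ₐ[ℂ] 𝒜) (ρ : 𝒜 →ₗ[ℂ] ℂ)
    (M : Matrix ι ι ℂ) : ρ (f M) = trace (pullbackDensity f ρ * M) := by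
  have hs : ∀ i j, f (Matrix.single i j (M i j)) = M i j • f (Matrix.single i j 1) := by
    intro i j
    rw [← map_smul, Matrix.smul_single, smul_eq_mul, mul_one]
  conv_lhs => rw [Matrix.matrix_eq_sum_single M]
  simp only [map_sum, hs, map_smul, smul_eq_mul, Matrix.trace, Matrix.diag, Matrix.mul_apply,
    pullbackDensity, Matrix.of_apply]
  rw [Finset.sum_comm]
  exact Finset.sum_congr rfl fun i _ => Finset.sum_congr rfl fun j _ => mul_comm _ _

theorem posSemidef_pullbackDensity (f : Matrix ι ι ℂ →⋆ₐ[ℂ] 𝒜) {ρ : 𝒜 →ₗ[ℂ] ℂ}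
    (hρ : ρ ∈ stateSpace 𝒜) : (pullbackDensity f ρ).PosSemidef := by
  have key : ∀ v : ι → ℂ, 0 ≤ star v ⬝ᵥ (pullbackDensity f ρ *ᵥ v) := by
    intro v
    cases isEmpty_or_nonempty ι
    · simp [dotProduct]
    obtain ⟨i₀⟩ := ‹Nonempty ι›
    -- Chosen so that `star M * M` is the rank-one matrix of `v`; positivity of `ρ` on it is the
    -- quadratic form of the density matrix at `v`.
    let M : Matrix ι ι ℂ := vecMulVec (Pi.single i₀ 1) (star v)
    have h := hρ.1 (f M)
    have hM : star M * M = vecMulVec v (star v) := by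
      simp [M, star_eq_conjTranspose, conjTranspose_vecMulVec, vecMulVec_mul_vecMulVec]
    rw [← map_star, ← map_mul, hM, apply_eq_trace_pullbackDensity, mul_vecMulVec,
      trace_vecMulVec, dotProduct_comm] at h
    exact h
  rw [← Matrix.isPositive_toEuclideanLin_iff, LinearMap.isPositive_iff_complex]
  intro v
  have h := star_nonneg_iff.2 (key v)
  have hv : inner ℂ ((pullbackDensity f ρ).toEuclideanLin v) v =
      star (star v.ofLp ⬝ᵥ (pullbackDensity f ρ *ᵥ v.ofLp)) := by
    rw [EuclideanSpace.inner_eq_star_dotProduct, Matrix.ofLp_toLpLin, Matrix.toLin'_apply,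
      Matrix.star_dotProduct, star_star, dotProduct_comm]
  rw [hv]
  obtain ⟨h1, h2⟩ := Complex.nonneg_iff.1 h
  exact ⟨Complex.ext rfl h2, h1⟩

/-- Frees the entropy from the isomorphism chosen in its definition: any two parametrizations differ
by a `*`-isomorphism, which preserves trace and functional calculus. -/
theorem vonNeumannEntropy_range (f : Matrix ι ι ℂ →⋆ₐ[ℂ] 𝒜) {ρ : 𝒜 →ₗ[ℂ] ℂ}
    (hρ : ρ ∈ stateSpace 𝒜) :
    vonNeumannEntropy f.range ρ =
      -(trace (pullbackDensity f ρ * cfc Real.log (pullbackDensity f ρ))).re := by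
  have := nontrivial_of_mem_stateSpace hρ
  let e : Matrix ι ι ℂ ≃⋆ₐ[ℂ] f.range := StarAlgEquiv.ofInjective f (starAlgHom_injective f)
  have h : ∃ k : ℕ, Nonempty (f.range ≃⋆ₐ[ℂ] Matrix (Fin k) (Fin k) ℂ) :=
    ⟨Fintype.card ι, ⟨e.symm.trans (reindexStarAlgEquiv (Fintype.equivFin ι))⟩⟩
  rw [vonNeumannEntropy, dif_pos h, matrixEntropy]
  generalize h.choose_spec.some = e₀
  let φ := e.trans e₀
  -- A density matrix is determined by its trace pairing with all matrices.
  have hφ : φ (pullbackDensity f ρ) = densityMatrix e₀ ρ := by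
    refine Matrix.ext_iff_trace_mul_right.2 fun N => ?_
    have h1 := apply_eq_trace_densityMatrix e₀ ρ (e (φ.symm N))
    have h2 : e₀ (e (φ.symm N)) = N := φ.apply_symm_apply N
    rw [h2] at h1
    have h3 := apply_eq_trace_pullbackDensity f ρ (φ.symm N)
    rw [← h1, ← Matrix.trace_map φ.symm, map_mul, φ.symm_apply_apply, ← h3]
    rfl
  rw [← hφ, trace_mul_cfc_map φ (posSemidef_pullbackDensity f hρ).1]

/-- The restriction of a state to a full matrix algebra, in diagonal form. -/
theorem exists_spectral_decomposition (f : Matrix ι ι ℂ →⋆ₐ[ℂ] 𝒜) {ρ : 𝒜 →ₗ[ℂ] ℂ}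
    (hρ : ρ ∈ stateSpace 𝒜) :
    ∃ (U : unitary (Matrix ι ι ℂ)) (p : ι → ℝ), (∀ i, 0 ≤ p i) ∧
      (∀ M, ρ (f M) = ∑ r, p r * (star (U : Matrix ι ι ℂ) * M * (U : Matrix ι ι ℂ)) r r) ∧
      vonNeumannEntropy f.range ρ = ∑ r, negMulLog (p r) := by
  have hD := posSemidef_pullbackDensity f hρ
  refine ⟨hD.1.eigenvectorUnitary, hD.1.eigenvalues, hD.eigenvalues_nonneg, fun M => ?_, ?_⟩
  · rw [apply_eq_trace_pullbackDensity]
    conv_lhs => rw [hD.1.spectral_theorem, Unitary.conjStarAlgAut_apply, Matrix.mul_assoc,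
      Matrix.mul_assoc, trace_mul_comm, Matrix.mul_assoc]
    simp [trace, diagonal_mul]
  · rw [vonNeumannEntropy_range f hρ, trace_mul_cfc_log hD.1]

/-- Up to a change of basis, a state on a full matrix algebra is diagonal. -/
theorem exists_diagonal (f : Matrix ι ι ℂ →⋆ₐ[ℂ] 𝒜) {ρ : 𝒜 →ₗ[ℂ] ℂ}
    (hρ : ρ ∈ stateSpace 𝒜) :
    ∃ (g : Matrix ι ι ℂ →⋆ₐ[ℂ] 𝒜) (p : ι → ℝ), g.range = f.range ∧ (∑ i, p i = 1) ∧
      (∀ i j, ρ (g (Matrix.single i j 1)) = if i = j then (p i : ℂ) else 0) ∧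
      vonNeumannEntropy f.range ρ = ∑ r, negMulLog (p r) := by
  obtain ⟨U, p, -, hp, hS⟩ := exists_spectral_decomposition f hρ
  let φ := Unitary.conjStarAlgAut ℂ (Matrix ι ι ℂ) U
  have hg : ∀ M, ρ (f (φ M)) = ∑ r, p r * M r r := by
    intro M
    rw [hp]
    refine Finset.sum_congr rfl fun r _ => ?_
    have : star (U : Matrix ι ι ℂ) * φ M * (U : Matrix ι ι ℂ) = M := φ.symm_apply_apply M
    rw [this]
  refine ⟨f.comp (φ : Matrix ι ι ℂ →⋆ₐ[ℂ] Matrix ι ι ℂ), p, ?_, ?_, fun i j => ?_, hS⟩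
  · ext x
    constructor
    · rintro ⟨M, rfl⟩
      exact ⟨φ M, rfl⟩
    · rintro ⟨M, rfl⟩
      exact ⟨φ.symm M, congrArg f (φ.apply_symm_apply M)⟩
  · have h := hg 1
    rw [map_one, map_one, hρ.2] at h
    rw [← Complex.ofReal_inj, Complex.ofReal_sum, Complex.ofReal_one, h]
    simp
  · refine (hg _).trans ?_
    by_cases h : i = j
    · subst h
      simp [Matrix.single_apply]
    · simp only [Matrix.single_apply, if_neg h]
      refine Finset.sum_eq_zero fun r _ => ?_
      rw [if_neg (by rintro ⟨rfl, rfl⟩; exact h rfl), mul_zero]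

end Spectral

/-! ### Matrix units, tensor products and the triangle inequality. -/

section MatrixUnits

open Matrix

variable {𝒜 : Type*} [CStarAlgebra 𝒜] {ι m n : Type*} [Fintype ι] [DecidableEq ι] [Fintype m]
  [DecidableEq m] [Fintype n] [DecidableEq n]

/-- The representation of a full matrix algebra defined by a system of matrix units. -/
noncomputable def matrixUnitsHom (u : ι → ι → 𝒜)
    (hmul : ∀ i j k l, u i j * u k l = if j = k then u i l else 0)
    (hstar : ∀ i j, star (u i j) = u j i) (hone : ∑ i, u i i = 1) : Matrix ι ι ℂ →⋆ₐ[ℂ] 𝒜 where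
  toFun M := ∑ i, ∑ j, M i j • u i j
  map_one' := by simpa [Matrix.one_apply, ite_smul] using hone
  map_mul' M N := by
    have h : ∀ i k, M i k • u i k * ∑ x, ∑ l, N x l • u x l = ∑ l, (M i k * N k l) • u i l := by
      intro i k
      rw [Finset.mul_sum, Finset.sum_eq_single k]
      · simp only [Finset.mul_sum, smul_mul_smul_comm, hmul, if_true]
      · intro x _ hx
        simp [Finset.mul_sum, hmul, hx.symm]
      · simp
    simp only [Finset.sum_mul, h, Matrix.mul_apply, Finset.sum_smul]
    exact Finset.sum_congr rfl fun i _ => Finset.sum_comm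
  map_zero' := by simp
  map_add' M N := by simp [add_smul, Finset.sum_add_distrib]
  commutes' r := by
    have : ∀ i j, (algebraMap ℂ (Matrix ι ι ℂ) r) i j • u i j = if i = j then r • u i i else 0 := by
      intro i j
      rw [Matrix.algebraMap_matrix_apply]
      split_ifs with h
      · subst h; rfl
      · simp
    simp only [this, Finset.sum_ite_eq, Finset.mem_univ, if_true]
    rw [← Finset.smul_sum, hone, Algebra.algebraMap_eq_smul_one]
  map_star' M := by
    simp only [star_sum, star_smul, hstar, Matrix.star_apply]
    exact Finset.sum_comm

theorem matrixUnitsHom_single (u : ι → ι → 𝒜) (hmul hstar hone) (i j : ι) :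
    matrixUnitsHom u hmul hstar hone (Matrix.single i j 1) = u i j := by
  change ∑ k, ∑ l, Matrix.single i j (1 : ℂ) k l • u k l = u i j
  rw [Finset.sum_eq_single i, Finset.sum_eq_single j]
  · simp
  · intro l _ hl
    simp [hl.symm]
  · simp
  · intro k _ hk
    simp [hk.symm]
  · simp

theorem apply_eq_sum_single (f : Matrix ι ι ℂ →⋆ₐ[ℂ] 𝒜) (M : Matrix ι ι ℂ) :
    f M = ∑ i, ∑ j, M i j • f (Matrix.single i j 1) := by
  conv_lhs => rw [Matrix.matrix_eq_sum_single M]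
  simp only [map_sum, ← map_smul, Matrix.smul_single, smul_eq_mul, mul_one]

theorem range_le_of_single_mem (f : Matrix ι ι ℂ →⋆ₐ[ℂ] 𝒜) (S : StarSubalgebra ℂ 𝒜)
    (h : ∀ i j, f (Matrix.single i j 1) ∈ S) : f.range ≤ S := by
  rintro _ ⟨M, rfl⟩
  change f M ∈ S
  rw [apply_eq_sum_single]
  exact sum_mem fun i _ => sum_mem fun j _ => S.smul_mem (h i j) _

theorem sum_single_diag (f : Matrix ι ι ℂ →⋆ₐ[ℂ] 𝒜) : ∑ i, f (Matrix.single i i 1) = 1 := by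
  rw [← map_sum, Matrix.sum_single_one, map_one]

/-- Two commuting representations of full matrix algebras combine to a representation of the tensor
product. -/
theorem exists_starAlgHom_prod (f : Matrix m m ℂ →⋆ₐ[ℂ] 𝒜) (g : Matrix n n ℂ →⋆ₐ[ℂ] 𝒜)
    (hfg : ∀ a ∈ f.range, ∀ b ∈ g.range, Commute a b) :
    ∃ h : Matrix (m × n) (m × n) ℂ →⋆ₐ[ℂ] 𝒜, h.range = f.range ⊔ g.range ∧
      ∀ i j, h (Matrix.single i j 1) =
        f (Matrix.single i.1 j.1 1) * g (Matrix.single i.2 j.2 1) := by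
  have hc : ∀ M N, Commute (f M) (g N) := fun M N => hfg _ ⟨M, rfl⟩ _ ⟨N, rfl⟩
  let u : m × n → m × n → 𝒜 := fun i j =>
    f (Matrix.single i.1 j.1 1) * g (Matrix.single i.2 j.2 1)
  have hmul : ∀ i j k l, u i j * u k l = if j = k then u i l else 0 := by
    rintro ⟨i, i'⟩ ⟨j, j'⟩ ⟨k, k'⟩ ⟨l, l'⟩
    simp only [u]
    rw [(hc _ _).symm.mul_mul_mul_comm, ← map_mul, ← map_mul]
    by_cases h : j = k
    · by_cases h' : j' = k'
      · subst h h'; simp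
      · simp [h', Matrix.single_mul_single_of_ne]
    · simp [h, Matrix.single_mul_single_of_ne]
  have hstar : ∀ i j, star (u i j) = u j i := by
    intro i j
    simp only [u, star_mul, ← map_star, star_eq_conjTranspose, conjTranspose_single, star_one]
    exact ((hc _ _).eq).symm
  have hone : ∑ i, u i i = 1 := by
    simp only [u, Fintype.sum_prod_type, ← Finset.mul_sum, sum_single_diag, mul_one]
  let h := matrixUnitsHom u hmul hstar hone
  have hs : ∀ i j, h (Matrix.single i j 1) = u i j := matrixUnitsHom_single u hmul hstar hone
  refine ⟨h, le_antisymm ?_ (sup_le ?_ ?_), hs⟩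
  · refine range_le_of_single_mem _ _ fun i j => ?_
    rw [hs]
    exact mul_mem (StarSubalgebra.mem_sup_left ⟨_, rfl⟩) (StarSubalgebra.mem_sup_right ⟨_, rfl⟩)
  · refine range_le_of_single_mem _ _ fun i j => ?_
    have : f (Matrix.single i j 1) = ∑ k, h (Matrix.single (i, k) (j, k) 1) := by
      simp only [hs, u, ← Finset.mul_sum, sum_single_diag, mul_one]
    rw [this]
    exact sum_mem fun k _ => ⟨_, rfl⟩
  · refine range_le_of_single_mem _ _ fun i j => ?_
    have : g (Matrix.single i j 1) = ∑ k, h (Matrix.single (k, i) (k, j) 1) := by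
      simp only [hs, u, ← Finset.sum_mul, sum_single_diag, one_mul]
    rw [this]
    exact sum_mem fun k _ => ⟨_, rfl⟩

/-- The Araki-Lieb triangle inequality for two commuting full matrix algebras. -/
theorem vonNeumannEntropy_range_le_add (f : Matrix m m ℂ →⋆ₐ[ℂ] 𝒜) (g : Matrix n n ℂ →⋆ₐ[ℂ] 𝒜)
    (hfg : ∀ a ∈ f.range, ∀ b ∈ g.range, Commute a b) {ρ : 𝒜 →ₗ[ℂ] ℂ} (hρ : ρ ∈ stateSpace 𝒜) :
    vonNeumannEntropy g.range ρ ≤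
      vonNeumannEntropy f.range ρ + vonNeumannEntropy (f.range ⊔ g.range) ρ := by
  obtain ⟨f', α, hf, hα1, hα, hSα⟩ := exists_diagonal f hρ
  obtain ⟨g', β, hg, -, hβ, hSβ⟩ := exists_diagonal g hρ
  obtain ⟨h, hr, hs⟩ := exists_starAlgHom_prod f' g' (by rwa [hf, hg])
  obtain ⟨U, p, hp0, hp, hSp⟩ := exists_spectral_decomposition h hρ
  rw [hSα, hSβ, ← hf, ← hg, ← hr, hSp]
  let W : Matrix (m × n) (m × n) ℂ := U
  -- The purification: column `r` of the eigenvector matrix, weighted by the root of its eigenvalue.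
  -- Both factors were diagonalized beforehand, so the marginals over `a` and `b` are `α` and `β`.
  let X : m → n → m × n → ℂ := fun a b r => √(p r) * W (a, b) r
  have hX : ∀ a b a' b', ∑ r, star (X a b r) * X a' b' r =
      ρ (f' (Matrix.single a a' 1) * g' (Matrix.single b b' 1)) := by
    intro a b a' b'
    rw [← hs (a, b) (a', b'), hp]
    refine Finset.sum_congr rfl fun r _ => ?_
    have h1 : (star W * Matrix.single (a, b) (a', b') (1 : ℂ) * W : Matrix _ _ ℂ) r r =
        star (W (a, b) r) * W (a', b') r := by
      rw [Matrix.mul_apply, Finset.sum_eq_single (a', b')]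
      · simp
      · intro x _ hx
        simp [hx]
      · simp
    change _ = _ * (star W * Matrix.single (a, b) (a', b') (1 : ℂ) * W : Matrix _ _ ℂ) r r
    rw [h1]
    have h2 : ((√(p r) : ℝ) : ℂ) * (√(p r) : ℝ) = p r := by
      rw [← Complex.ofReal_mul, Real.mul_self_sqrt (hp0 r)]
    simp only [X, star_mul', RCLike.star_def, Complex.conj_ofReal]
    rw [← h2]
    ring
  have hn : ∀ z : ℂ, ((Complex.normSq z : ℝ) : ℂ) = star z * z := fun z =>
    Complex.normSq_eq_conj_mul_self
  refine sum_negMulLog_marginal_le X α β p (fun a => ?_) (fun r => ?_) (fun b b' => ?_) hα1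
  · rw [← Complex.ofReal_inj]
    push_cast
    simp only [hn, hX]
    rw [← map_sum, ← Finset.mul_sum, sum_single_diag, mul_one, hα, if_pos rfl]
  · have h1 : (star W * W) r r = 1 := by
      have : star W * W = 1 := Unitary.coe_star_mul_self U
      rw [this, Matrix.one_apply_eq]
    rw [← Complex.ofReal_inj]
    simp only [X, Complex.normSq_mul, ← Finset.mul_sum, Complex.normSq_ofReal,
      Real.mul_self_sqrt (hp0 r)]
    rw [Matrix.mul_apply, Fintype.sum_prod_type] at h1
    push_cast
    simp only [hn]
    simp only [Matrix.star_apply] at h1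
    rw [h1, mul_one]
  · simp only [hX]
    rw [← map_sum, ← Finset.sum_mul, sum_single_diag, one_mul, hβ]

end MatrixUnits

/-! ### Subalgebras that are full matrix algebras. -/

section FullMatrix

variable {𝒜 : Type*} [CStarAlgebra 𝒜]

/-- The subalgebra `B` is the image of a full matrix algebra. -/
def IsFullMatrixAlgebra (B : StarSubalgebra ℂ 𝒜) : Prop :=
  ∃ (ι : Type) (_ : Fintype ι) (_ : DecidableEq ι) (f : Matrix ι ι ℂ →⋆ₐ[ℂ] 𝒜), f.range = B

theorem isFullMatrixAlgebra_of_starAlgEquiv {B : StarSubalgebra ℂ 𝒜} {k : ℕ}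
    (e : B ≃⋆ₐ[ℂ] Matrix (Fin k) (Fin k) ℂ) : IsFullMatrixAlgebra B := by
  refine ⟨Fin k, inferInstance, inferInstance,
    B.subtype.comp (e.symm : Matrix (Fin k) (Fin k) ℂ →⋆ₐ[ℂ] B), ?_⟩
  ext x
  constructor
  · rintro ⟨M, rfl⟩
    exact (e.symm M).2
  · intro hx
    exact ⟨e ⟨x, hx⟩, congrArg Subtype.val (e.symm_apply_apply ⟨x, hx⟩)⟩

theorem IsFullMatrixAlgebra.sup {B₁ B₂ : StarSubalgebra ℂ 𝒜} (h₁ : IsFullMatrixAlgebra B₁)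
    (h₂ : IsFullMatrixAlgebra B₂) (hc : ∀ a ∈ B₁, ∀ b ∈ B₂, Commute a b) :
    IsFullMatrixAlgebra (B₁ ⊔ B₂) := by
  obtain ⟨ι, _, _, f, rfl⟩ := h₁
  obtain ⟨κ, _, _, g, rfl⟩ := h₂
  obtain ⟨h, hr, -⟩ := exists_starAlgHom_prod f g hc
  exact ⟨ι × κ, inferInstance, inferInstance, h, hr⟩

theorem vonNeumannEntropy_le_add {B₁ B₂ : StarSubalgebra ℂ 𝒜} (h₁ : IsFullMatrixAlgebra B₁)
    (h₂ : IsFullMatrixAlgebra B₂) (hc : ∀ a ∈ B₁, ∀ b ∈ B₂, Commute a b) {ρ : 𝒜 →ₗ[ℂ] ℂ}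
    (hρ : ρ ∈ stateSpace 𝒜) :
    vonNeumannEntropy B₂ ρ ≤ vonNeumannEntropy B₁ ρ + vonNeumannEntropy (B₁ ⊔ B₂) ρ := by
  obtain ⟨ι, _, _, f, rfl⟩ := h₁
  obtain ⟨κ, _, _, g, rfl⟩ := h₂
  exact vonNeumannEntropy_range_le_add f g hc hρ

theorem range_le_of_mem_adjoin {s : Set 𝒜} (T : StarAlgebra.adjoin ℂ s →⋆ₐ[ℂ] 𝒜)
    (S : StarSubalgebra ℂ 𝒜)
    (h : ∀ x (hx : x ∈ s), T ⟨x, StarAlgebra.subset_adjoin ℂ s hx⟩ ∈ S) : T.range ≤ S := by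
  rintro _ ⟨a, rfl⟩
  change T a ∈ S
  induction a using StarAlgebra.adjoin_induction_subtype with
  | mem x hx => exact h x hx
  | algebraMap r => rw [AlgHomClass.commutes]; exact S.algebraMap_mem r
  | add x y hx hy => rw [map_add]; exact add_mem hx hy
  | mul x y hx hy => rw [map_mul]; exact mul_mem hx hy
  | star x hx => rw [map_star]; exact star_mem hx

/-- The representation `x ↦ p * f x + q * g x`, for complementary projections `p` and `q`. -/
noncomputable def twist {B : Type*} [Ring B] [StarRing B] [Algebra ℂ B] (f g : B →⋆ₐ[ℂ] 𝒜)
    (p q : 𝒜) (hpp : p * p = p) (hqq : q * q = q) (hpq : p * q = 0) (hqp : q * p = 0)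
    (h1 : p + q = 1) (hps : star p = p) (hqs : star q = q) (hp : ∀ x, Commute p (f x))
    (hq : ∀ x, Commute q (g x)) : B →⋆ₐ[ℂ] 𝒜 where
  toFun x := p * f x + q * g x
  map_one' := by simp [h1]
  map_mul' x y := by
    have e1 : p * f x * (p * f y) = p * (f x * f y) := by
      rw [(hp x).eq, mul_assoc, ← mul_assoc p p, hpp, ← mul_assoc, ← (hp x).eq, mul_assoc]
    have e2 : q * g x * (q * g y) = q * (g x * g y) := by
      rw [(hq x).eq, mul_assoc, ← mul_assoc q q, hqq, ← mul_assoc, ← (hq x).eq, mul_assoc]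
    have e3 : p * f x * (q * g y) = 0 := by
      rw [(hp x).eq, mul_assoc, ← mul_assoc p q, hpq, zero_mul, mul_zero]
    have e4 : q * g x * (p * f y) = 0 := by
      rw [(hq x).eq, mul_assoc, ← mul_assoc q p, hqp, zero_mul, mul_zero]
    rw [map_mul, map_mul, add_mul, mul_add, mul_add, e1, e2, e3, e4, add_zero, zero_add]
  map_zero' := by simp
  map_add' x y := by simp only [map_add, mul_add]; abel
  commutes' r := by
    rw [AlgHomClass.commutes, AlgHomClass.commutes, ← add_mul, h1, one_mul]
  map_star' x := by
    rw [star_add, star_mul, star_mul, hps, hqs, map_star, map_star]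
    have e1 : Commute p (star (f x)) := by rw [← map_star]; exact hp _
    have e2 : Commute q (star (g x)) := by rw [← map_star]; exact hq _
    rw [e1.eq, e2.eq]

theorem range_comp_codRestrict {ι : Type*} [Fintype ι] [DecidableEq ι] {B : StarSubalgebra ℂ 𝒜}
    (T : B →⋆ₐ[ℂ] 𝒜) (f : Matrix ι ι ℂ →⋆ₐ[ℂ] 𝒜) (hf : f.range = B) (hm : ∀ M, f M ∈ B) :
    (T.comp (f.codRestrict B hm)).range = T.range := by
  ext x
  constructor
  · rintro ⟨M, rfl⟩
    exact ⟨_, rfl⟩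
  · rintro ⟨⟨y, hy⟩, rfl⟩
    subst hf
    obtain ⟨M, rfl⟩ := hy
    exact ⟨M, rfl⟩

theorem IsFullMatrixAlgebra.range {B : StarSubalgebra ℂ 𝒜} (hB : IsFullMatrixAlgebra B)
    (T : B →⋆ₐ[ℂ] 𝒜) : IsFullMatrixAlgebra T.range := by
  obtain ⟨ι, _, _, f, hf⟩ := hB
  exact ⟨ι, inferInstance, inferInstance, _,
    range_comp_codRestrict T f hf fun M => hf ▸ ⟨M, rfl⟩⟩

/-- Matrix units of `B` and their images under `T` yield the same density matrix. -/
theorem vonNeumannEntropy_range_eq {B : StarSubalgebra ℂ 𝒜} (hB : IsFullMatrixAlgebra B)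
    (T : B →⋆ₐ[ℂ] 𝒜) {ρ : 𝒜 →ₗ[ℂ] ℂ} (hρ : ρ ∈ stateSpace 𝒜) (h : ∀ x, ρ (T x) = ρ x) :
    vonNeumannEntropy T.range ρ = vonNeumannEntropy B ρ := by
  obtain ⟨ι, _, _, f, hf⟩ := hB
  have hm : ∀ M, f M ∈ B := fun M => hf ▸ ⟨M, rfl⟩
  have hd : pullbackDensity (T.comp (f.codRestrict B hm)) ρ = pullbackDensity f ρ := by
    ext a b
    exact h _
  rw [← range_comp_codRestrict T f hf hm, vonNeumannEntropy_range _ hρ, hd,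
    ← vonNeumannEntropy_range f hρ, hf]

end FullMatrix

/-! ### Fermion algebras and the Jordan-Wigner transformation. -/

namespace FermionSystem

variable {Γ 𝒜 : Type*} [DecidableEq Γ] [CStarAlgebra 𝒜] (F : FermionSystem Γ 𝒜)

theorem c_mem_loc {I : Finset Γ} {i : Γ} (hi : i ∈ I) : F.c i ∈ F.loc I :=
  StarAlgebra.subset_adjoin ℂ _ ⟨i, hi, rfl⟩

theorem loc_le {I : Finset Γ} {S : StarSubalgebra ℂ 𝒜} (h : ∀ i ∈ I, F.c i ∈ S) :
    F.loc I ≤ S := by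
  refine StarAlgebra.adjoin_le ?_
  rintro _ ⟨i, hi, rfl⟩
  exact h i hi

theorem range_le {J : Finset Γ} (T : F.loc J →⋆ₐ[ℂ] 𝒜) (S : StarSubalgebra ℂ 𝒜)
    (h : ∀ j (hj : j ∈ J), T ⟨F.c j, F.c_mem_loc hj⟩ ∈ S) : T.range ≤ S := by
  refine range_le_of_mem_adjoin T S ?_
  rintro _ ⟨j, hj, rfl⟩
  exact h j hj

theorem loc_mono {I J : Finset Γ} (h : I ⊆ J) : F.loc I ≤ F.loc J :=
  F.loc_le fun _ hi => F.c_mem_loc (h hi)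

theorem c_mul_c (i j : Γ) : F.c i * F.c j = -(F.c j * F.c i) :=
  eq_neg_of_add_eq_zero_left (F.anticomm i j)

theorem star_c_mul_c {i j : Γ} (h : i ≠ j) : star (F.c i) * F.c j = -(F.c j * star (F.c i)) :=
  eq_neg_of_add_eq_zero_left ((F.anticomm_star i j).trans (if_neg h))

theorem c_mul_c_self (i : Γ) : F.c i * F.c i = 0 := by
  have h := F.anticomm i i
  rw [← two_smul ℂ] at h
  exact (smul_eq_zero.1 h).resolve_left two_ne_zero

theorem c_mul_star_c_self (i : Γ) : F.c i * star (F.c i) = 1 - star (F.c i) * F.c i :=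
  eq_sub_of_add_eq' ((F.anticomm_star i i).trans (if_pos rfl))

theorem c_mul_star_c_mul_c (i : Γ) : F.c i * (star (F.c i) * F.c i) = F.c i := by
  rw [← mul_assoc, c_mul_star_c_self, sub_mul, one_mul, mul_assoc, c_mul_c_self, mul_zero, sub_zero]

theorem star_c_mul_star_c_self (i : Γ) : star (F.c i) * star (F.c i) = 0 := by
  rw [← star_mul, c_mul_c_self, star_zero]

theorem star_c_mul_c_mul_star_c (i : Γ) :
    star (F.c i) * (F.c i * star (F.c i)) = star (F.c i) := by
  have := congrArg star (F.c_mul_star_c_mul_c i)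
  rwa [star_mul, star_mul, star_star, mul_assoc] at this

/-- The parity operator of a finite region. -/
theorem exists_parity {Θ : 𝒜 ≃⋆ₐ[ℂ] 𝒜} (hΘ : F.IsGrading Θ) (I : Finset Γ) :
    ∃ V ∈ F.loc I, star V = V ∧ V * V = 1 ∧ Θ V = V ∧ (∀ i ∈ I, V * F.c i = -(F.c i * V)) ∧
      ∀ j ∉ I, Commute V (F.c j) := by
  induction I using Finset.induction_on with
  | empty => exact ⟨1, one_mem _, star_one _, one_mul 1, map_one Θ, by simp, by simp⟩
  | insert i I hi ih =>
    obtain ⟨V, hV, hs, h1, hΘV, ha, hc⟩ := ih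
    set n := star (F.c i) * F.c i with hn
    have hnn : n * n = n := by rw [hn, mul_assoc, c_mul_star_c_mul_c]
    have hns : star n = n := by rw [hn, star_mul, star_star]
    have hΘn : Θ n = n := by rw [hn, map_mul, map_star, hΘ i, star_neg, neg_mul_neg]
    have hVn : Commute V n := by
      have h2 : Commute V (star (F.c i)) := by
        have := (hc i hi).star_star
        rwa [hs] at this
      exact h2.mul_right (hc i hi)
    have hnc : n * F.c i = 0 := by rw [hn, mul_assoc, c_mul_c_self, mul_zero]
    have hcn : F.c i * n = F.c i := F.c_mul_star_c_mul_c i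
    have hnj : ∀ j ≠ i, Commute n (F.c j) := by
      intro j hj
      change star (F.c i) * F.c i * F.c j = F.c j * (star (F.c i) * F.c i)
      rw [mul_assoc, F.c_mul_c i j, mul_neg, ← mul_assoc, F.star_c_mul_c hj.symm, neg_mul, neg_neg,
        mul_assoc]
    -- The one-site parity, with value `1` on the empty and `-1` on the occupied state; the parity
    -- of a region is the product of these.
    let w := 1 - (n + n)
    have hVw : Commute V w := (Commute.one_right V).sub_right (hVn.add_right hVn)
    have hww : w * w = 1 := by
      simp only [w, sub_mul, mul_sub, add_mul, mul_add, hnn, one_mul, mul_one]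
      abel
    have hws : star w = w := by simp [w, hns]
    have hwi : w * F.c i = F.c i := by simp [w, sub_mul, add_mul, hnc]
    have hiw : F.c i * w = -F.c i := by simp [w, mul_sub, mul_add, hcn]
    have hwj : ∀ j ≠ i, Commute w (F.c j) := fun j hj =>
      (Commute.one_left _).sub_left ((hnj j hj).add_left (hnj j hj))
    have hwmem : w ∈ F.loc (insert i I) := by
      have h3 := F.c_mem_loc (Finset.mem_insert_self i I)
      have h4 : n ∈ F.loc (insert i I) := mul_mem (star_mem h3) h3
      exact sub_mem (one_mem _) (add_mem h4 h4)
    refine ⟨V * w, mul_mem (F.loc_mono (Finset.subset_insert i I) hV) hwmem, ?_, ?_, ?_, ?_, ?_⟩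
    · rw [star_mul, hs, hws, hVw.eq]
    · rw [hVw.symm.mul_mul_mul_comm, h1, hww, one_mul]
    · rw [map_mul, hΘV]
      simp [w, hΘn]
    · intro j hj
      by_cases h : j = i
      · subst h
        rw [mul_assoc, hwi, ← mul_assoc, ← (hc j hi).eq, mul_assoc, hiw, mul_neg, neg_neg]
      · rw [mul_assoc, (hwj j h).eq, ← mul_assoc,
          ha j (Finset.mem_of_mem_insert_of_ne hj h), neg_mul, mul_assoc]
    · intro j hj
      rw [Finset.mem_insert, not_or] at hj
      exact (hc j hj.2).mul_left (hwj j hj.1)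

/-- The algebra of a region `J` disjoint from `I` has a copy that commutes with the algebra of `I`,
generates the algebra of `I ∪ J` with it, and carries the same restriction of an even functional
(the Jordan-Wigner transformation). -/
theorem exists_twist {Θ : 𝒜 ≃⋆ₐ[ℂ] 𝒜} (hΘ : F.IsGrading Θ) {I J : Finset Γ} (hIJ : Disjoint I J) :
    ∃ T : F.loc J →⋆ₐ[ℂ] 𝒜, (∀ a ∈ F.loc I, ∀ b ∈ T.range, Commute a b) ∧
      F.loc I ⊔ T.range = F.loc (I ∪ J) ∧
      ∀ ρ : 𝒜 →ₗ[ℂ] ℂ, (∀ a, ρ (Θ a) = ρ a) → ∀ x, ρ (T x) = ρ x := by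
  obtain ⟨V, hV, hs, h1, hΘV, ha, hc⟩ := F.exists_parity hΘ I
  have hcJ : ∀ j ∈ J, Commute V (F.c j) := fun j hj => hc j (Finset.disjoint_right.1 hIJ hj)
  have hVJ : ∀ x ∈ F.loc J, Commute V x := by
    have : F.loc J ≤ StarSubalgebra.centralizer ℂ {V} := F.loc_le fun j hj => by
      rw [StarSubalgebra.mem_centralizer_iff]
      rintro _ rfl
      rw [hs]
      exact ⟨hcJ j hj, hcJ j hj⟩
    intro x hx
    exact ((StarSubalgebra.mem_centralizer_iff ℂ).1 (this hx) V rfl).1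
  have hΘJ : ∀ x ∈ F.loc J, Θ x ∈ F.loc J := by
    have : F.loc J ≤ (F.loc J).comap (Θ : 𝒜 →⋆ₐ[ℂ] 𝒜) := F.loc_le fun j hj => by
      change Θ (F.c j) ∈ F.loc J
      rw [hΘ j]
      exact neg_mem (F.c_mem_loc hj)
    exact fun x hx => this hx
  let p : 𝒜 := (1 / 2 : ℂ) • (1 + V)
  let q : 𝒜 := (1 / 2 : ℂ) • (1 - V)
  have hpp : p * p = p := by
    simp only [p, smul_mul_smul_comm, mul_add, add_mul, one_mul, mul_one, h1]
    module
  have hqq : q * q = q := by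
    simp only [q, smul_mul_smul_comm, mul_sub, sub_mul, one_mul, mul_one, h1]
    module
  have hpq : p * q = 0 := by
    simp only [p, q, smul_mul_smul_comm, mul_sub, add_mul, one_mul, mul_one, h1]
    module
  have hqp : q * p = 0 := by
    simp only [p, q, smul_mul_smul_comm, mul_add, sub_mul, one_mul, mul_one, h1]
    module
  have hadd : p + q = 1 := by
    simp only [p, q]
    module
  have hps : star p = p := by simp [p, hs]
  have hqs : star q = q := by simp [q, hs]
  have hp : ∀ x ∈ F.loc J, Commute p x := fun x hx =>
    ((Commute.one_left x).add_left (hVJ x hx)).smul_left _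
  have hq : ∀ x ∈ F.loc J, Commute q x := fun x hx =>
    ((Commute.one_left x).sub_left (hVJ x hx)).smul_left _
  -- With `p`, `q` the spectral projections of `V`, the map is the identity on the even sector of
  -- `I` and `Θ` on the odd one. It sends `c j` to `(p - q) * c j = V * c j`, and the formula makes
  -- it a `*`-homomorphism without a presentation of `F.loc J`.
  let T : F.loc J →⋆ₐ[ℂ] 𝒜 := twist (F.loc J).subtype
    ((Θ : 𝒜 →⋆ₐ[ℂ] 𝒜).comp (F.loc J).subtype) p q hpp hqq hpq hqp hadd hps hqs
    (fun x => hp _ x.2) (fun x => hq _ (hΘJ _ x.2))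
  have hT : ∀ x : F.loc J, T x = (1 / 2 : ℂ) • (x + Θ x + V * x - V * Θ x) := by
    intro x
    change p * (x : 𝒜) + q * Θ x = _
    simp only [p, q, smul_mul_assoc, add_mul, sub_mul, one_mul]
    module
  have hTc : ∀ j (hj : j ∈ J), T ⟨F.c j, F.c_mem_loc hj⟩ = V * F.c j := by
    intro j hj
    rw [hT, hΘ j, mul_neg]
    module
  refine ⟨T, fun a haI b hb => ?_, le_antisymm (sup_le (F.loc_mono Finset.subset_union_left) ?_)
    (F.loc_le fun i hi => ?_), fun ρ hρ x => ?_⟩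
  -- For `i ∈ I` both `V` and `c j` anticommute with `c i`, and the two signs cancel.
  · have hgen : ∀ j ∈ J, ∀ a ∈ F.loc I, Commute a (V * F.c j) := by
      intro j hj
      have : F.loc I ≤ StarSubalgebra.centralizer ℂ {V * F.c j} := F.loc_le fun i hi => by
        have hij : i ≠ j := fun h => Finset.disjoint_left.1 hIJ hi (h ▸ hj)
        rw [StarSubalgebra.mem_centralizer_iff]
        rintro _ rfl
        constructor
        · rw [mul_assoc, F.c_mul_c j i, mul_neg, ← mul_assoc, ha i hi, neg_mul, neg_neg, mul_assoc]
        · rw [star_mul, hs, mul_assoc, ha i hi, mul_neg, ← mul_assoc, F.star_c_mul_c hij.symm,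
            neg_mul, neg_neg, mul_assoc]
      intro a haI
      exact (((StarSubalgebra.mem_centralizer_iff ℂ).1 (this haI) _ rfl).1).symm
    have : T.range ≤ StarSubalgebra.centralizer ℂ (F.loc I : Set 𝒜) := by
      refine F.range_le T _ fun j hj => ?_
      rw [StarSubalgebra.mem_centralizer_iff]
      intro a haI
      rw [hTc j hj]
      exact ⟨hgen j hj a haI, hgen j hj _ (star_mem haI)⟩
    exact ((StarSubalgebra.mem_centralizer_iff ℂ).1 (this hb) a haI).1
  · refine F.range_le T _ fun j hj => ?_
    rw [hTc j hj]
    exact mul_mem (F.loc_mono Finset.subset_union_left hV)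
      (F.c_mem_loc (Finset.mem_union_right I hj))
  · rcases Finset.mem_union.1 hi with hi | hi
    · exact StarSubalgebra.mem_sup_left (F.c_mem_loc hi)
    · have h2 : F.c i = V * T ⟨F.c i, F.c_mem_loc hi⟩ := by
        rw [hTc i hi, ← mul_assoc, h1, one_mul]
      rw [h2]
      exact mul_mem (StarSubalgebra.mem_sup_left hV) (StarSubalgebra.mem_sup_right ⟨_, rfl⟩)
  -- `V` is even, so an even `ρ` does not distinguish the two terms containing `V`; they cancel in
  -- `ρ (T x)`.
  · have h2 : ρ (V * Θ x) = ρ (V * x) := by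
      rw [← hρ (V * x), map_mul Θ, hΘV]
    rw [hT, map_smul, map_sub, map_add, map_add, hρ, h2, smul_eq_mul]
    ring

theorem isFullMatrixAlgebra_loc_singleton (i : Γ) : IsFullMatrixAlgebra (F.loc {i}) := by
  -- Matrix units of one site: `true` is the empty state, `false` the occupied one, and `c i` maps
  -- occupied to empty.
  let u : Bool → Bool → 𝒜 := fun a b => bif a then (bif b then F.c i * star (F.c i) else F.c i)
    else (bif b then star (F.c i) else star (F.c i) * F.c i)
  have e1 : ∀ x, F.c i * (F.c i * x) = 0 := fun x => by rw [← mul_assoc, c_mul_c_self, zero_mul]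
  have e2 : ∀ x, star (F.c i) * (star (F.c i) * x) = 0 := fun x => by
    rw [← mul_assoc, star_c_mul_star_c_self, zero_mul]
  have hmul : ∀ a b c d, u a b * u c d = if b = c then u a d else 0 := by
    intro a b c d
    cases a <;> cases b <;> cases c <;> cases d <;>
      simp [u, mul_assoc, c_mul_star_c_mul_c, star_c_mul_c_mul_star_c, c_mul_c_self,
        star_c_mul_star_c_self, e1, e2]
  have hstar : ∀ a b, star (u a b) = u b a := by
    intro a b
    cases a <;> cases b <;> simp [u]
  have hone : ∑ a, u a a = 1 := by
    simp [u, c_mul_star_c_self]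
  refine ⟨Bool, inferInstance, inferInstance, matrixUnitsHom u hmul hstar hone,
    le_antisymm (range_le_of_single_mem _ _ fun a b => ?_) (F.loc_le fun j hj => ?_)⟩
  · rw [matrixUnitsHom_single]
    have h := F.c_mem_loc (Finset.mem_singleton_self i)
    cases a <;> cases b
    · exact mul_mem (star_mem h) h
    · exact star_mem h
    · exact h
    · exact mul_mem h (star_mem h)
  · rw [Finset.mem_singleton.1 hj]
    exact ⟨Matrix.single true false 1, matrixUnitsHom_single u hmul hstar hone true false⟩

theorem isFullMatrixAlgebra_loc {Θ : 𝒜 ≃⋆ₐ[ℂ] 𝒜} (hΘ : F.IsGrading Θ) (I : Finset Γ) :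
    IsFullMatrixAlgebra (F.loc I) := by
  induction I using Finset.induction_on with
  | empty =>
    refine ⟨Unit, inferInstance, inferInstance,
      matrixUnitsHom (fun _ _ => 1) (by simp) (by simp) (by simp),
      le_antisymm (range_le_of_single_mem _ _ fun a b => ?_) (F.loc_le (by simp))⟩
    rw [matrixUnitsHom_single]
    exact one_mem _
  | insert i I hi ih =>
    -- The twisted copy of the new site commutes with `F.loc I`, so one more tensor factor is split
    -- off.
    obtain ⟨T, hc, hT, -⟩ := F.exists_twist hΘ (Finset.disjoint_singleton_right.2 hi)
    rw [Finset.insert_eq, Finset.union_comm, ← hT]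
    exact ih.sup ((F.isFullMatrixAlgebra_loc_singleton i).range T) hc

end FermionSystem

/-! ### The triangle inequality on the lattice and the mutual entropy. -/

variable {Γ 𝒜 : Type*} [DecidableEq Γ] [CStarAlgebra 𝒜]

theorem SpinSystem.vonNeumannEntropy_le_add (Q : SpinSystem Γ 𝒜) {ρ : 𝒜 →ₗ[ℂ] ℂ}
    (hρ : ρ ∈ stateSpace 𝒜) {I J : Finset Γ} (hIJ : Disjoint I J) :
    vonNeumannEntropy (Q.loc J) ρ ≤
      vonNeumannEntropy (Q.loc I) ρ + vonNeumannEntropy (Q.loc (I ∪ J)) ρ := by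
  have hfull : ∀ I, IsFullMatrixAlgebra (Q.loc I) := fun I =>
    let ⟨_, ⟨e⟩⟩ := Q.fullMatrix I
    isFullMatrixAlgebra_of_starAlgEquiv e
  rw [Q.union I J hIJ]
  exact QuantumLattice.vonNeumannEntropy_le_add (hfull I) (hfull J) (Q.commute I J hIJ) hρ

theorem FermionSystem.vonNeumannEntropy_le_add (F : FermionSystem Γ 𝒜) {ρ : 𝒜 →ₗ[ℂ] ℂ}
    (hρ : ρ ∈ stateSpace 𝒜) (hev : F.IsEven ρ) {I J : Finset Γ} (hIJ : Disjoint I J) :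
    vonNeumannEntropy (F.loc J) ρ ≤
      vonNeumannEntropy (F.loc I) ρ + vonNeumannEntropy (F.loc (I ∪ J)) ρ := by
  obtain ⟨Θ, hΘ, hΘρ⟩ := hev
  obtain ⟨T, hc, hT, hTρ⟩ := F.exists_twist hΘ hIJ
  have hJ := F.isFullMatrixAlgebra_loc hΘ J
  rw [← hT, ← vonNeumannEntropy_range_eq hJ T hρ (hTρ ρ hΘρ)]
  exact QuantumLattice.vonNeumannEntropy_le_add (F.isFullMatrixAlgebra_loc hΘ I)
    (hJ.range T) hc hρ

/-- The triangle inequality for the entropy bounds the mutual entropy by twice the entropy. -/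
theorem mutualEntropy_compl_le (loc : Finset Γ → StarSubalgebra ℂ 𝒜) (ρ : 𝒜 →ₗ[ℂ] ℂ)
    (h : ∀ I J, Disjoint I J → vonNeumannEntropy (loc J) ρ ≤
      vonNeumannEntropy (loc I) ρ + vonNeumannEntropy (loc (I ∪ J)) ρ) (A : Finset Γ) :
    mutualEntropy loc ρ A (A : Set Γ)ᶜ ≤ ((2 * vonNeumannEntropy (loc A) ρ : ℝ) : EReal) := by
  have hcond : ((-vonNeumannEntropy (loc A) ρ : ℝ) : EReal) ≤
      conditionalEntropy loc ρ A (A : Set Γ)ᶜ := by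
    refine le_iInf₂ fun Λ hΛ => EReal.coe_le_coe_iff.2 ?_
    have hd : Disjoint A Λ := by
      rw [← Finset.disjoint_coe]
      exact (Set.subset_compl_iff_disjoint_left).1 hΛ
    linarith [h A Λ hd]
  refine (EReal.sub_le_sub le_rfl hcond).trans_eq ?_
  rw [← EReal.coe_sub]
  congr 1
  ring

end QuantumLattice

open QuantumLattice in
/-- `Fb` is any family of finite regions, and `bd` assigns to each region its boundary, in
whatever sense: nothing is assumed of either. -/
theorem proposition4 {Γ 𝒜 : Type*} [DecidableEq Γ] [CStarAlgebra 𝒜]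
    (Fb : Set (Finset Γ)) (bd : Finset Γ → Finset Γ) (c : ℝ) (hc : 0 < c) (ρ : 𝒜 →ₗ[ℂ] ℂ)
    (hρ : IsPureState ρ) :
    (∀ Q : SpinSystem Γ 𝒜,
      (∀ A ∈ Fb, vonNeumannEntropy (Q.loc A) ρ ≤ c * (bd A).card) →
        ∀ A ∈ Fb, mutualEntropy Q.loc ρ A (A : Set Γ)ᶜ ≤ ((2 * c * (bd A).card : ℝ) : EReal)) ∧
    (∀ F : FermionSystem Γ 𝒜, F.IsEven ρ →
      (∀ A ∈ Fb, vonNeumannEntropy (F.loc A) ρ ≤ c * (bd A).card) →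
        ∀ A ∈ Fb, mutualEntropy F.loc ρ A (A : Set Γ)ᶜ ≤ ((2 * c * (bd A).card : ℝ) : EReal)) := by
  have hs : ρ ∈ stateSpace 𝒜 := hρ.1
  refine ⟨fun Q h A hA => ?_, fun F hev h A hA => ?_⟩
  · refine (mutualEntropy_compl_le Q.loc ρ
      (fun _ _ => Q.vonNeumannEntropy_le_add hs) A).trans (EReal.coe_le_coe_iff.2 ?_)
    linarith [h A hA]
  · refine (mutualEntropy_compl_le F.loc ρ
      (fun _ _ => F.vonNeumannEntropy_le_add hs hev) A).trans (EReal.coe_le_coe_iff.2 ?_)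
    linarith [h A hA]
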